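/- **Slab reduction.** Let $M\ge 2$, and write $\mathbb{Z}_M=\mathbb{Z}/M\mathbb{Z}$. For $A,B\subset\mathbb{Z}_M$, write $A\oplus B=\mathbb{Z}_M$ if every $x\in\mathbb{Z}_M$ is uniquely of the form $a+b$ with $a\in A$, $b\in B$. Let $A(X)=\sum_{a\in A}X^a$ (with representatives $0\le a<M$), and write $\Phi_s\mid A$ if the cyclotomic polynomial $\Phi_s$ divides $A(X)$. We say that $A$ satisfies (T2) if, whenever $k\ge 1$ and $s_1,\dots,s_k$ are powers (with positive exponents) of different primes with $\Phi_{s_j}\mid A$ for all $j$, also $\Phi_{s_1\cdots s_k}\mid A$. Let $\mathrm{Div}(A)=\{\gcd(a-a',M): a,a'\in A\}$. Let $M=\prod_{j=1}^K p_j^{n_j}$ with distinct primes $p_j$ and $n_j\ge1$, and $M_j=M/p_j^{n_j}$. Each $x\in\mathbb{Z}_M$ is uniquely $x=\sum_j\pi_j(x)M_j$ with $\pi_j(x)\in\{0,\dots,p_j^{n_j}-1\}$. For $A\subset\mathbb{Z}_M$ let $A_{p_i}=\{a\in A: 0\le\pi_i(a)\le p_i^{n_i-1}-1\}$. Assume that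 $A\oplus B=\mathbb{Z}_M$ and that for some $i\in\{1,\dots,K\}$: - (T2) holds for both $A'$ and $B'$ in every tiling $A'\oplus B'=\mathbb{Z}_{M/p_i}$ with $|A'|=|A|/p_i$ and $|B'|=|B|$; - $\Phi_{p_i^{n_i}}\mid A$; - at least one of the following conditions holds: (i) for every translate $A'$ of $A$, $A'_{p_i}\oplus B=\mathbb{Z}_{M/p_i}$ (that is, the elements of $A'_{p_i}$ are distinct modulo $M/p_i$, so are the elements of $B$, and the reductions of $A'_{p_i}$ and $B$ modulo $M/p_i$ tile $\mathbb{Z}_{M/p_i}$); (ii) for every $d$ with $p_i^{n_i}\mid d\mid M$, $\Phi_d\mid A$ or $\Phi_{d/p_i}\Phi_{d/p_i^2}\cdots\Phi_{d/p_i^{n_i}}\mid B$; (iii) for every $m$ with $p_i^{n_i}\mid m\mid M$, if $m\in\mathrm{Div}(A)$ then $m/p_i\notin\mathrm{Div}(B)$. Then $A$ and $B$ satisfy (T2). -/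

import Mathlib

namespace CyclicTiling

open Polynomial

/-- The tiling relation `A ⊕ B = ℤ_M`: every element of `ℤ_M` is `a + b` for exactly one pair
`(a, b)` with `a ∈ A`, `b ∈ B`. -/
def IsTiling {M : ℕ} (A B : Finset (ZMod M)) : Prop :=
  ∀ x : ZMod M, ∃! ab : ZMod M × ZMod M, ab.1 ∈ A ∧ ab.2 ∈ B ∧ ab.1 + ab.2 = x

/-- The mask polynomial `A(X) = ∑_{a ∈ A} X^a`, with elements of `ℤ_M` represented by
`0, 1, …, M - 1`. -/
noncomputable def mask {M : ℕ} (A : Finset (ZMod M)) : ℤ[X] :=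
  ∑ a ∈ A, X ^ a.val

/-- `S_A`: the set of prime powers `s = p ^ α` (`α ≥ 1`) such that `Φ_s` divides `A(X)`. -/
def primePowerDivisors {M : ℕ} (A : Finset (ZMod M)) : Set ℕ :=
  {s | IsPrimePow s ∧ cyclotomic s ℤ ∣ mask A}

/-- The Coven-Meyerowitz condition (T2): if `s₁, …, s_k ∈ S_A` (`k ≥ 1`) are powers of different
primes, then `Φ_{s₁ ⋯ s_k}` divides `A(X)`. Prime powers are powers of different primes exactly
when they are coprime. -/
def SatisfiesT2 {M : ℕ} (A : Finset (ZMod M)) : Prop :=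
  ∀ S : Finset ℕ, S.Nonempty → (∀ s ∈ S, s ∈ primePowerDivisors A) →
    (∀ s ∈ S, ∀ t ∈ S, s ≠ t → Nat.Coprime s t) →
    cyclotomic (∏ s ∈ S, s) ℤ ∣ mask A

/-- The divisor set `Div(A) = {(a - a', M) : a, a' ∈ A}`. -/
def divisorSet {M : ℕ} (A : Finset (ZMod M)) : Set ℕ :=
  {m | ∃ a ∈ A, ∃ a' ∈ A, m = Nat.gcd (a - a').val M}

/-- The translate `A + t`. -/
def translate {M : ℕ} (A : Finset (ZMod M)) (t : ZMod M) : Finset (ZMod M) :=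
  A.image (fun a => a + t)

/-- `A` considered modulo `N`, where `N ∣ M`. -/
def reduceMod {M : ℕ} (N : ℕ) (A : Finset (ZMod M)) : Finset (ZMod N) :=
  A.image (fun a => (a.cast : ZMod N))

/-- `A ⊕ B = ℤ_N` with `A, B ⊆ ℤ_M` considered modulo `N`, where `N ∣ M`: both reductions are
sets (no two elements are congruent modulo `N`), and these sets tile `ℤ_N`. -/
def IsTilingMod {M : ℕ} (N : ℕ) (A B : Finset (ZMod M)) : Prop :=
  Set.InjOn (fun a : ZMod M => (a.cast : ZMod N)) (A : Set (ZMod M)) ∧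
  Set.InjOn (fun b : ZMod M => (b.cast : ZMod N)) (B : Set (ZMod M)) ∧
  IsTiling (reduceMod N A) (reduceMod N B)

/-- The array coordinate `π_p(x) ∈ ℤ_{p^n}` of `x ∈ ℤ_M`, where `p ^ n` is the exact power of the
prime `p` in `M`. The coordinates are determined by `x = ∑_p π_p(x) M_p` with `M_p = M / p ^ n`
(see `sum_arrayCoord`); modulo `p ^ n` this reads `x ≡ π_p(x) M_p`, and `M_p` is a unit there. -/
def arrayCoord {M : ℕ} (p : ℕ) (x : ZMod M) : ZMod (p ^ M.factorization p) :=
  (x.cast : ZMod (p ^ M.factorization p)) *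
    ((M / p ^ M.factorization p : ℕ) : ZMod (p ^ M.factorization p))⁻¹

/-- The slab `A_p = {a ∈ A : 0 ≤ π_p(a) ≤ p ^ (n - 1) - 1}`, with `ℤ_{p^n}` represented by
`0, 1, …, p ^ n - 1`. -/
def slab {M : ℕ} (p : ℕ) (A : Finset (ZMod M)) : Finset (ZMod M) :=
  A.filter (fun a => (arrayCoord p a).val < p ^ (M.factorization p - 1))

/-- For every translate `A'` of `A`, `A'_p ⊕ B = ℤ_{M/p}`. -/
def SlabTiling {M : ℕ} (p : ℕ) (A B : Finset (ZMod M)) : Prop :=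
  ∀ t : ZMod M, IsTilingMod (M / p) (slab p (translate A t)) B

/-- For every `d` with `p ^ n ∣ d ∣ M`, either `Φ_d ∣ A` or
`Φ_{d/p} Φ_{d/p²} ⋯ Φ_{d/p^n} ∣ B`. -/
def SlabCyclotomic {M : ℕ} (p : ℕ) (A B : Finset (ZMod M)) : Prop :=
  ∀ d : ℕ, p ^ M.factorization p ∣ d → d ∣ M →
    cyclotomic d ℤ ∣ mask A ∨
      (∏ α ∈ Finset.Icc 1 (M.factorization p), cyclotomic (d / p ^ α) ℤ) ∣ mask B

/-- For every `m` with `p ^ n ∣ m ∣ M`, if `m ∈ Div(A)` then `m / p ∉ Div(B)`. -/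
def SlabDivisor {M : ℕ} (p : ℕ) (A B : Finset (ZMod M)) : Prop :=
  ∀ m : ℕ, p ^ M.factorization p ∣ m → m ∣ M →
    m ∈ divisorSet A → m / p ∉ divisorSet B

/-- The expansion that determines the array coordinates. -/
theorem sum_arrayCoord {M : ℕ} (hM : M ≠ 0) (x : ZMod M) :
    x = ∑ p ∈ M.primeFactors,
      (((arrayCoord p x).val * (M / p ^ M.factorization p) : ℕ) : ZMod M) := by
  have : NeZero M := ⟨hM⟩
  set y : ℕ := ∑ p ∈ M.primeFactors, (arrayCoord p x).val * (M / p ^ M.factorization p) with hy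
  have key : ∀ q ∈ M.primeFactors, x.val ≡ y [MOD q ^ M.factorization q] := by
    intro q hq
    have hqp := Nat.prime_of_mem_primeFactors hq
    have : NeZero (q ^ M.factorization q) := ⟨pow_ne_zero _ hqp.ne_zero⟩
    have hdvd : q ^ M.factorization q ∣ M := Nat.ordProj_dvd M q
    rw [← ZMod.natCast_eq_natCast_iff, hy, Nat.cast_sum, Finset.sum_eq_single q]
    · have hu : IsUnit ((M / q ^ M.factorization q : ℕ) : ZMod (q ^ M.factorization q)) := by
        rw [ZMod.isUnit_iff_coprime]
        exact ((Nat.coprime_ordCompl hqp hM).symm).pow_right _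
      rw [Nat.cast_mul, ZMod.natCast_zmod_val, arrayCoord, mul_assoc,
        ZMod.inv_mul_of_unit _ hu, mul_one, ZMod.natCast_val]
    · intro r hr hrq
      have hrp := Nat.prime_of_mem_primeFactors hr
      rw [ZMod.natCast_eq_zero_iff]
      apply Dvd.dvd.mul_left
      have hc : Nat.Coprime (q ^ M.factorization q) (r ^ M.factorization r) :=
        Nat.Coprime.pow _ _ ((Nat.coprime_primes hqp hrp).2 (Ne.symm hrq))
      apply hc.dvd_of_dvd_mul_left
      rwa [Nat.mul_div_cancel' (Nat.ordProj_dvd M r)]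
    · intro h; exact absurd hq h
  have hmod : x.val ≡ y [MOD M] := by
    rw [Nat.modEq_iff_dvd]
    have h2 : (∏ q ∈ M.primeFactors, ((q ^ M.factorization q : ℕ) : ℤ)) ∣ (y : ℤ) - x.val := by
      apply Finset.prod_dvd_of_coprime
      · intro q hq r hr hqr
        exact (Nat.isCoprime_iff_coprime).2 (Nat.Coprime.pow _ _
          ((Nat.coprime_primes (Nat.prime_of_mem_primeFactors hq)
            (Nat.prime_of_mem_primeFactors hr)).2 hqr))
      · intro q hq
        exact (Nat.modEq_iff_dvd).1 (key q hq)
    rw [← Nat.cast_prod] at h2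
    have h3 : ∏ q ∈ M.primeFactors, q ^ M.factorization q = M :=
      Nat.prod_factorization_pow_eq_self hM
    rwa [h3] at h2
  rw [← ZMod.natCast_eq_natCast_iff, ZMod.natCast_zmod_val] at hmod
  exact hmod.trans (by rw [hy, Nat.cast_sum])

end CyclicTiling

/-! Write n for the exponent of p in M. Tilings are read at roots of unity: `A ⊕ B = ℤ_N` means
A(z)B(z) = 1 + z + ... + z^(N-1) whenever z^N = 1, and Φ_d ∣ A means that A vanishes at a primitive
d-th root. Group A(z) into the parts F_c(z) of array coordinate c (`fiberSum`). If θ^(p^n) = 1, then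
A(θz) is a Fourier coefficient of c ↦ F_c(z), and slabs of translates of A are windows of p^(n-1)
consecutive fibers.

Each of the other two conditions implies `SlabTiling`. Under `SlabCyclotomic`, F_c(z)B(z) is
p^(n-1)-periodic in c when z^(M/p) = 1, so each of the p windows carries the same share of A(z)B(z).
Under `SlabDivisor`, sums from a slab and B cannot collide modulo M/p, because divisor sets of
tiling factors meet only in M; counting does the rest.

Given `SlabTiling`, (T2) holds for B and for all slabs reduced modulo M/p. As Φ_{p^n} ∣ A, it does
not divide B, so every prime power of B divides M/p and (T2) passes to B. Any other prime power s of
A has Φ_s ∤ B, so Φ_s divides every slab; hence so does Φ_d for the product d of such s. Adding p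
windows gives Φ_d ∣ A. If p^n is also among the chosen powers, vanishing of all windows makes
F_c(ζ), with ζ of order d, p^(n-1)-periodic in c; its Fourier coefficients at primitive p^n-th roots
then vanish, so Φ_{p^n d} ∣ A (`cyclotomic_mul_dvd_mask_of_slab`). -/

namespace CyclicTiling

open Polynomial Finset

variable {R : Type*} [CommRing R] {M N p : ℕ}

/-! ### Exponential sums over subsets of `ℤ_M` -/

/-- The exponential sum `∑ a ∈ A, z ^ a`, the value of the mask polynomial at `z`. -/
def expSum (A : Finset (ZMod M)) (z : R) : R := ∑ a ∈ A, z ^ a.val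

/-- The sums `a + b`, with `a ∈ A` and `b ∈ B`, represent every residue modulo `N` exactly once. -/
def UniqueSums (N : ℕ) (A B : Finset (ZMod M)) : Prop :=
  ∀ x : ZMod N, #{ab ∈ A ×ˢ B | (ab.1.cast + ab.2.cast : ZMod N) = x} = 1

theorem pow_val_add [NeZero N] {z : R} (hz : z ^ N = 1) (x y : ZMod N) :
    z ^ (x + y).val = z ^ x.val * z ^ y.val := by
  rw [ZMod.val_add, ← pow_eq_pow_mod _ hz, pow_add]

theorem pow_val_natCast {z : R} (hz : z ^ N = 1) (k : ℕ) :
    z ^ (k : ZMod N).val = z ^ k := by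
  rw [ZMod.val_natCast, ← pow_eq_pow_mod _ hz]

theorem pow_val_cast [NeZero M] {z : R} (hz : z ^ N = 1) (x : ZMod M) :
    z ^ (x.cast : ZMod N).val = z ^ x.val := by
  rw [ZMod.cast_eq_val, pow_val_natCast hz]

theorem pow_val_eq_of_natCast_eq {z : R} (hz : z ^ N = 1) {k l : ℕ}
    (h : (k : ZMod N) = l) : z ^ k = z ^ l := by
  rw [← pow_val_natCast hz, h, pow_val_natCast hz]

theorem expSum_univ [NeZero N] (z : R) :
    expSum (univ : Finset (ZMod N)) z = ∑ i ∈ range N, z ^ i := by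
  obtain ⟨n, rfl⟩ := Nat.exists_eq_succ_of_ne_zero (NeZero.ne N)
  exact Fin.sum_univ_eq_sum_range (fun i => z ^ i) (n + 1)

theorem expSum_one (A : Finset (ZMod M)) : expSum A (1 : R) = #A := by
  simp [expSum]

theorem expSum_univ_eq_zero [NeZero N] {z : ℂ} (hz : z ^ N = 1) (h1 : z ≠ 1) :
    expSum (univ : Finset (ZMod N)) z = 0 := by
  rw [expSum_univ]
  have := mul_geom_sum z N
  rw [hz, sub_self] at this
  exact (mul_eq_zero.1 this).resolve_left (sub_ne_zero.2 h1)

theorem eval_mask (A : Finset (ZMod M)) (z : R) : aeval z (mask A) = expSum A z := by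
  simp [mask, expSum]

theorem cyclotomic_dvd_iff_aeval {d : ℕ} (hd : d ≠ 0) {z : ℂ} (hz : IsPrimitiveRoot z d)
    (P : ℤ[X]) : cyclotomic d ℤ ∣ P ↔ aeval z P = 0 := by
  rw [cyclotomic_eq_minpoly hz (Nat.pos_of_ne_zero hd),
    minpoly.isIntegrallyClosed_dvd_iff (hz.isIntegral (Nat.pos_of_ne_zero hd))]

theorem cyclotomic_dvd_mask_iff {d : ℕ} (hd : d ≠ 0) {z : ℂ} (hz : IsPrimitiveRoot z d)
    (A : Finset (ZMod M)) : cyclotomic d ℤ ∣ mask A ↔ expSum A z = 0 := by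
  rw [cyclotomic_dvd_iff_aeval hd hz, eval_mask]

theorem expSum_reduceMod [NeZero M] {A : Finset (ZMod M)}
    (hA : Set.InjOn (fun a : ZMod M => (a.cast : ZMod N)) (A : Set (ZMod M)))
    {z : R} (hz : z ^ N = 1) : expSum (reduceMod N A) z = expSum A z := by
  rw [expSum, reduceMod, sum_image hA]
  exact sum_congr rfl fun a _ => pow_val_cast hz a

/-- Injectivity of the Fourier transform: a polynomial of degree below N with N roots is zero. -/
theorem sum_pow_val_eq_zero [NeZero N] (f : ZMod N → ℂ)
    (h : ∀ z : ℂ, z ^ N = 1 → ∑ x, f x * z ^ x.val = 0) : f = 0 := by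
  have hN := Nat.pos_of_ne_zero (NeZero.ne N)
  set P : ℂ[X] := ∑ x, C (f x) * X ^ x.val with hP
  have hdeg : P.natDegree < N := by
    refine (natDegree_sum_le_of_forall_le (n := N - 1) _ _ fun x _ => ?_).trans_lt (by omega)
    exact (natDegree_C_mul_X_pow_le _ _).trans (Nat.le_sub_one_of_lt x.val_lt)
  have h0 : P = 0 := by
    refine eq_zero_of_natDegree_lt_card_of_eval_eq_zero' P (nthRootsFinset N 1) ?_ ?_
    · intro z hz
      rw [mem_nthRootsFinset hN] at hz
      simpa [hP, eval_finsetSum] using h z hz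
    · rwa [(Complex.isPrimitiveRoot_exp N hN.ne').card_nthRootsFinset]
  ext x
  have hc : P.coeff x.val = f x := by
    rw [hP, finsetSum_coeff, sum_eq_single x]
    · simp
    · intro y _ hy
      rw [coeff_C_mul_X_pow, if_neg]
      exact fun hxy => hy (ZMod.val_injective N hxy).symm
    · simp
  rw [← hc, h0]
  simp

/-! ### Tilings as identities at roots of unity -/

theorem sum_product_pow_val [NeZero M] [NeZero N] (A B : Finset (ZMod M)) {z : R}
    (hz : z ^ N = 1) :
    ∑ ab ∈ A ×ˢ B, z ^ (ab.1.cast + ab.2.cast : ZMod N).val = expSum A z * expSum B z := by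
  rw [expSum, expSum, sum_mul_sum, sum_product]
  refine sum_congr rfl fun a _ => sum_congr rfl fun b _ => ?_
  rw [pow_val_add hz, pow_val_cast hz, pow_val_cast hz]

theorem sum_card_mul_pow_val [NeZero M] [NeZero N] (A B : Finset (ZMod M)) {z : R}
    (hz : z ^ N = 1) :
    ∑ x : ZMod N, (#{ab ∈ A ×ˢ B | (ab.1.cast + ab.2.cast : ZMod N) = x} : R) * z ^ x.val =
      expSum A z * expSum B z := by
  rw [← sum_product_pow_val A B hz,
    ← sum_fiberwise (A ×ˢ B) (fun ab => (ab.1.cast + ab.2.cast : ZMod N))]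
  refine sum_congr rfl fun x _ => ?_
  rw [sum_congr rfl (g := fun _ => z ^ x.val) (fun ab hab => by rw [(mem_filter.1 hab).2]),
    sum_const, nsmul_eq_mul]

theorem UniqueSums.expSum_mul [NeZero M] [NeZero N] {A B : Finset (ZMod M)}
    (h : UniqueSums N A B) {z : R} (hz : z ^ N = 1) :
    expSum A z * expSum B z = expSum (univ : Finset (ZMod N)) z := by
  rw [← sum_card_mul_pow_val A B hz, expSum]
  refine sum_congr rfl fun x _ => ?_
  rw [h x, Nat.cast_one, one_mul]

theorem uniqueSums_of_expSum [NeZero M] [NeZero N] {A B : Finset (ZMod M)}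
    (h : ∀ z : ℂ, z ^ N = 1 →
      expSum A z * expSum B z = expSum (univ : Finset (ZMod N)) z) : UniqueSums N A B := by
  have := sum_pow_val_eq_zero (N := N)
    (fun x => (#{ab ∈ A ×ˢ B | (ab.1.cast + ab.2.cast : ZMod N) = x} : ℂ) - 1) (by
      intro z hz
      simp only [sub_mul, one_mul, sum_sub_distrib]
      rw [sum_card_mul_pow_val A B hz, h z hz, expSum, sub_self])
  intro x
  have hx := congrFun this x
  rw [Pi.zero_apply, sub_eq_zero] at hx
  exact_mod_cast hx

theorem UniqueSums.card_mul [NeZero M] [NeZero N] {A B : Finset (ZMod M)}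
    (h : UniqueSums N A B) : #A * #B = N := by
  have := h.expSum_mul (R := ℤ) (z := 1) (one_pow _)
  simp only [expSum_one, card_univ, ZMod.card] at this
  exact_mod_cast this

theorem UniqueSums.eq_of_add_eq {A B : Finset (ZMod M)} (h : UniqueSums N A B)
    {a a' b b' : ZMod M} (ha : a ∈ A) (ha' : a' ∈ A) (hb : b ∈ B) (hb' : b' ∈ B)
    (hab : (a.cast + b.cast : ZMod N) = a'.cast + b'.cast) : a = a' ∧ b = b' := by
  have := card_le_one.1 (h (a'.cast + b'.cast)).le (a, b) (by simp [ha, hb, hab])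
    (a', b') (by simp [ha', hb'])
  exact Prod.mk.inj this

theorem UniqueSums.exists_add_eq {A B : Finset (ZMod M)} (h : UniqueSums N A B) (x : ZMod N) :
    ∃ a ∈ A, ∃ b ∈ B, (a.cast + b.cast : ZMod N) = x := by
  obtain ⟨ab, hab⟩ := card_pos.1 (by rw [h x]; exact one_pos)
  simp only [mem_filter, mem_product] at hab
  exact ⟨ab.1, hab.1.1, ab.2, hab.1.2, hab.2⟩

theorem uniqueSums_of_card_mul [NeZero N] {A B : Finset (ZMod M)} (hcard : #A * #B = N)
    (hinj : ∀ a ∈ A, ∀ a' ∈ A, ∀ b ∈ B, ∀ b' ∈ B,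
      (a.cast + b.cast : ZMod N) = a'.cast + b'.cast → a = a' ∧ b = b') : UniqueSums N A B := by
  have hle : ∀ x ∈ (univ : Finset (ZMod N)),
      #{ab ∈ A ×ˢ B | (ab.1.cast + ab.2.cast : ZMod N) = x} ≤ 1 := by
    intro x _
    refine card_le_one.2 fun u hu v hv => ?_
    simp only [mem_filter, mem_product] at hu hv
    exact Prod.ext_iff.2 (hinj _ hu.1.1 _ hv.1.1 _ hu.1.2 _ hv.1.2 (hu.2.trans hv.2.symm))
  have hsum : ∑ x : ZMod N, #{ab ∈ A ×ˢ B | (ab.1.cast + ab.2.cast : ZMod N) = x} =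
      ∑ x : ZMod N, 1 := by
    rw [← card_eq_sum_card_fiberwise (fun _ _ => mem_coe.2 (mem_univ _)), card_product, hcard]
    simp [ZMod.card]
  exact fun x => (sum_eq_sum_iff_of_le hle).1 hsum x (mem_univ x)

theorem isTiling_iff_uniqueSums {A B : Finset (ZMod M)} :
    IsTiling A B ↔ UniqueSums M A B := by
  refine forall_congr' fun x => ?_
  rw [card_eq_one, ExistsUnique]
  refine exists_congr fun ab => ?_
  simp only [ZMod.cast_id', id, Finset.ext_iff, mem_filter, mem_product, mem_singleton]
  constructor
  · rintro ⟨⟨h1, h2, h3⟩, h4⟩ cd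
    exact ⟨fun h => h4 cd ⟨h.1.1, h.1.2, h.2⟩, fun h => h ▸ ⟨⟨h1, h2⟩, h3⟩⟩
  · intro h
    have h1 := (h ab).2 rfl
    exact ⟨⟨h1.1.1, h1.1.2, h1.2⟩, fun cd hcd => (h cd).1 ⟨⟨hcd.1, hcd.2.1⟩, hcd.2.2⟩⟩

theorem UniqueSums.injOn_left {A B : Finset (ZMod M)} (h : UniqueSums N A B) :
    Set.InjOn (fun a : ZMod M => (a.cast : ZMod N)) (A : Set (ZMod M)) := by
  obtain ⟨-, -, b, hb, -⟩ := h.exists_add_eq 0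
  intro a ha a' ha' haa
  exact (h.eq_of_add_eq ha ha' hb hb (by rw [show (a.cast : ZMod N) = a'.cast from haa])).1

theorem UniqueSums.injOn_right {A B : Finset (ZMod M)} (h : UniqueSums N A B) :
    Set.InjOn (fun a : ZMod M => (a.cast : ZMod N)) (B : Set (ZMod M)) := by
  obtain ⟨a, ha, -, -, -⟩ := h.exists_add_eq 0
  intro b hb b' hb' hbb
  exact (h.eq_of_add_eq ha ha hb hb' (by rw [show (b.cast : ZMod N) = b'.cast from hbb])).2

theorem isTilingMod_iff_uniqueSums [NeZero M] [NeZero N] {A B : Finset (ZMod M)} :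
    IsTilingMod N A B ↔ UniqueSums N A B := by
  constructor
  · rintro ⟨hA, hB, h⟩
    refine uniqueSums_of_expSum fun z hz => ?_
    rw [← expSum_reduceMod hA hz, ← expSum_reduceMod hB hz]
    exact (isTiling_iff_uniqueSums.1 h).expSum_mul hz
  · intro h
    refine ⟨h.injOn_left, h.injOn_right, isTiling_iff_uniqueSums.2 ?_⟩
    refine uniqueSums_of_expSum fun z hz => ?_
    rw [expSum_reduceMod h.injOn_left hz, expSum_reduceMod h.injOn_right hz]
    exact h.expSum_mul hz

theorem UniqueSums.cyclotomic_dvd [NeZero M] [NeZero N] {A B : Finset (ZMod M)}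
    (h : UniqueSums N A B) {d : ℕ} (hd : d ∣ N) (hd1 : d ≠ 1) :
    cyclotomic d ℤ ∣ mask A ∨ cyclotomic d ℤ ∣ mask B := by
  have hd0 : d ≠ 0 := ne_zero_of_dvd_ne_zero (NeZero.ne N) hd
  have hz := Complex.isPrimitiveRoot_exp d hd0
  rw [cyclotomic_dvd_mask_iff hd0 hz, cyclotomic_dvd_mask_iff hd0 hz, ← mul_eq_zero]
  have hzN := hz.pow_eq_one_iff_dvd N |>.2 hd
  rw [h.expSum_mul hzN, expSum_univ_eq_zero hzN]
  intro h1
  rw [h1] at hz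
  exact hd1 (hz.unique IsPrimitiveRoot.one)

/-! ### Prime power cyclotomic factors in a tiling -/

theorem geom_sum_dvd_mask_mul [NeZero M] {A B : Finset (ZMod M)} (h : UniqueSums M A B) :
    ∑ i ∈ range M, (X : ℤ[X]) ^ i ∣ mask A * mask B := by
  -- The identity is used at the generic M-th root of unity in ℤ[X]/(X^M - 1), so that the quotient
  -- has integer coefficients and can be evaluated at 1.
  set f : ℤ[X] := X ^ M - 1 with hf
  have hz : AdjoinRoot.root f ^ M = 1 := by
    have := AdjoinRoot.eval₂_root f
    rwa [hf, eval₂_sub, eval₂_X_pow, eval₂_one, sub_eq_zero] at this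
  have hmk : ∀ A : Finset (ZMod M), expSum A (AdjoinRoot.root f) = AdjoinRoot.mk f (mask A) :=
    fun A => by simp [expSum, mask]
  have h1 := h.expSum_mul hz
  rw [hmk, hmk, ← map_mul, expSum_univ, ← AdjoinRoot.mk_X] at h1
  simp only [← map_pow, ← map_sum] at h1
  rw [AdjoinRoot.mk_eq_mk] at h1
  have h2 : ∑ i ∈ range M, (X : ℤ[X]) ^ i ∣ f := ⟨X - 1, (geom_sum_mul X M).symm⟩
  exact (dvd_sub_left dvd_rfl).1 (h2.trans h1)

theorem sq_cyclotomic_not_dvd_X_pow_sub_one (hM : M ≠ 0) {s : ℕ} (hs : s ≠ 0) :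
    ¬ cyclotomic s ℤ ^ 2 ∣ X ^ M - 1 := by
  rintro ⟨Q, hQ⟩
  have hz := Complex.isPrimitiveRoot_exp s hs
  set z := Complex.exp (2 * Real.pi * Complex.I / s)
  have h0 : aeval z (cyclotomic s ℤ) = 0 := (cyclotomic_dvd_iff_aeval hs hz _).1 dvd_rfl
  have h1 := congrArg (fun P => aeval z (derivative P)) hQ
  simp only [derivative_one, derivative_mul, derivative_pow,
    map_sub, map_mul, map_add, map_pow, h0, aeval_X] at h1
  simp [hM, hz.ne_zero hs] at h1

theorem eval_one_mask (A : Finset (ZMod M)) : (mask A).eval 1 = #A := by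
  have := eval_mask A (1 : ℤ)
  rwa [expSum_one, coe_aeval_eq_eval] at this

/-- In a tiling, a prime power cyclotomic factor of one mask polynomial has index dividing `M`,
and does not divide the other mask polynomial. -/
theorem UniqueSums.primePowerDivisors [NeZero M] {A B : Finset (ZMod M)} (h : UniqueSums M A B)
    {s : ℕ} (hs : IsPrimePow s) (hsA : cyclotomic s ℤ ∣ mask A) :
    s ∣ M ∧ ¬ cyclotomic s ℤ ∣ mask B := by
  have hs0 : s ≠ 0 := hs.ne_zero
  obtain ⟨Q, hQ⟩ := geom_sum_dvd_mask_mul h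
  -- At 1 both |A||B| and the geometric sum equal M, so Q(1) = 1. Since Φ_s(1) is a prime for a
  -- prime power s, Φ_s cannot divide Q.
  have hQ1 : Q.eval 1 = 1 := by
    have := congrArg (eval 1) hQ
    rw [eval_mul, eval_mul, eval_one_mask, eval_one_mask, eval_geom_sum] at this
    simp only [one_pow, sum_const, card_range, nsmul_eq_mul, mul_one] at this
    rw [← Nat.cast_mul, h.card_mul] at this
    exact (mul_eq_left₀ (Nat.cast_ne_zero.2 (NeZero.ne M))).1 this.symm
  have hprime : Prime (cyclotomic s ℤ) := (cyclotomic.irreducible (Nat.pos_of_ne_zero hs0)).prime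
  have hnQ : ¬ cyclotomic s ℤ ∣ Q := by
    intro hd
    obtain ⟨p, k, hp, hk, rfl⟩ := hs
    obtain ⟨k, rfl⟩ := Nat.exists_eq_succ_of_ne_zero hk.ne'
    have : Fact p.Prime := ⟨hp.nat_prime⟩
    have := eval_dvd (x := 1) hd
    rw [hQ1, eval_one_cyclotomic_prime_pow] at this
    exact hp.nat_prime.one_lt.ne' (by exact_mod_cast Int.eq_one_of_dvd_one (by positivity) this)
  have hgeom : ∑ i ∈ range M, (X : ℤ[X]) ^ i ∣ X ^ M - 1 := ⟨X - 1, (geom_sum_mul X M).symm⟩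
  constructor
  · have h1 : cyclotomic s ℤ ∣ X ^ M - 1 :=
      (((hprime.dvd_mul).1 (hQ ▸ hsA.mul_right _)).resolve_right hnQ).trans hgeom
    have hz := Complex.isPrimitiveRoot_exp s hs0
    have h2 := (cyclotomic_dvd_iff_aeval hs0 hz _).1 h1
    rw [map_sub, map_pow, aeval_X, map_one, sub_eq_zero] at h2
    exact (hz.pow_eq_one_iff_dvd M).1 h2
  · intro hsB
    have h1 : cyclotomic s ℤ ^ 2 ∣ (∑ i ∈ range M, (X : ℤ[X]) ^ i) * Q := by
      rw [← hQ, sq]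
      exact mul_dvd_mul hsA hsB
    exact sq_cyclotomic_not_dvd_X_pow_sub_one (NeZero.ne M) hs0
      ((hprime.pow_dvd_of_dvd_mul_right 2 hnQ h1).trans hgeom)

theorem UniqueSums.swap {N : ℕ} {A B : Finset (ZMod M)} (h : UniqueSums N A B) :
    UniqueSums N B A := by
  intro x
  rw [← h x]
  refine card_bij (fun ab _ => ab.swap) ?_ ?_ ?_
  · intro ab hab
    simp only [mem_filter, mem_product] at hab ⊢
    exact ⟨hab.1.symm, by rw [add_comm]; exact hab.2⟩
  · intro a _ b _ hab
    exact Prod.swap_injective hab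
  · intro ab hab
    simp only [mem_filter, mem_product] at hab
    exact ⟨ab.swap, by simpa [mem_filter, mem_product, and_comm, add_comm] using hab, by simp⟩

/-! ### Multiplication by units and divisor sets -/

theorem expSum_image_mul [NeZero M] (u : (ZMod M)ˣ) (A : Finset (ZMod M)) {z : ℂ}
    (hz : z ^ M = 1) :
    expSum (A.image (fun a => (u : ZMod M) * a)) z = expSum A (z ^ (u : ZMod M).val) := by
  rw [expSum, sum_image fun a _ b _ hab => u.mul_right_inj.1 hab]
  refine sum_congr rfl fun a _ => ?_
  rw [← pow_mul]
  refine pow_val_eq_of_natCast_eq hz ?_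
  simp

/-- Multiplying one factor of a tiling by a unit gives a tiling. -/
theorem UniqueSums.image_mul [NeZero M] {A B : Finset (ZMod M)} (h : UniqueSums M A B)
    (u : (ZMod M)ˣ) : UniqueSums M (A.image (fun a => (u : ZMod M) * a)) B := by
  refine uniqueSums_of_expSum fun z hz => ?_
  rw [expSum_image_mul u A hz]
  by_cases h1 : z = 1
  · rw [h1, one_pow, ← h1, h.expSum_mul hz]
  have hd0 : orderOf z ≠ 0 :=
    (orderOf_pos_iff.2 (isOfFinOrder_iff_pow_eq_one.2 ⟨M, NeZero.pos M, hz⟩)).ne'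
  have hzd := IsPrimitiveRoot.orderOf z
  -- z^u has the same order as z, so A vanishes at both or at neither.
  have hcop : (u : ZMod M).val.Coprime (orderOf z) :=
    (ZMod.val_coe_unit_coprime u).coprime_dvd_right (orderOf_dvd_of_pow_eq_one hz)
  have hz0 : expSum (univ : Finset (ZMod M)) z = 0 := expSum_univ_eq_zero hz h1
  have h2 := h.expSum_mul hz
  rw [hz0, mul_eq_zero] at h2 ⊢
  rwa [← cyclotomic_dvd_mask_iff hd0 (hzd.pow_of_coprime _ hcop),
    cyclotomic_dvd_mask_iff hd0 hzd]

theorem exists_unit_mul_gcd [NeZero M] (x : ZMod M) :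
    ∃ u : (ZMod M)ˣ, x = u * (Nat.gcd x.val M : ℕ) := by
  obtain ⟨d, hd, u, hu, hx⟩ := ZMod.eq_unit_mul_divisor x
  obtain ⟨u, rfl⟩ := hu
  refine ⟨u, ?_⟩
  have h1 : Nat.gcd x.val M = d := by
    have h2 : x.val ≡ (u : ZMod M).val * d [MOD M] := by
      rw [← ZMod.natCast_eq_natCast_iff]
      simpa using hx
    rw [h2.gcd_eq, Nat.Coprime.gcd_mul_left_cancel _ (ZMod.val_coe_unit_coprime u),
      Nat.gcd_eq_left hd]
  rw [h1, ← hx]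

/-- The divisor sets of the two factors of a tiling have only `M` in common. -/
theorem UniqueSums.eq_of_gcd_eq [NeZero M] {A B : Finset (ZMod M)} (h : UniqueSums M A B)
    {a a' b b' : ZMod M} (ha : a ∈ A) (ha' : a' ∈ A) (hb : b ∈ B) (hb' : b' ∈ B)
    (hgcd : Nat.gcd (a - a').val M = Nat.gcd (b - b').val M) : a = a' ∧ b = b' := by
  obtain ⟨u, hu⟩ := exists_unit_mul_gcd (a - a')
  obtain ⟨v, hv⟩ := exists_unit_mul_gcd (b - b')
  -- Differences with equal gcd are unit multiples of each other. Scaling A by that unit r gives ra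
  -- + b' = ra' + b, against uniqueness of sums unless both differences are trivial.
  have hr : ((v * u⁻¹ : (ZMod M)ˣ) : ZMod M) * (a - a') = b - b' := by
    rw [hu, hv, hgcd, Units.val_mul, mul_assoc, Units.inv_mul_cancel_left]
  have := (h.image_mul (v * u⁻¹)).eq_of_add_eq (mem_image_of_mem _ ha)
    (mem_image_of_mem _ ha') hb' hb (by
      simp only [ZMod.cast_id', id]
      linear_combination hr)
  exact ⟨(v * u⁻¹).mul_right_inj.1 this.1, this.2.symm⟩

/-! ### Array coordinates, fibers and slabs -/

theorem pow_factorization_eq (hp : p.Prime) (hM : M ≠ 0) (hpM : p ∣ M) :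
    p ^ M.factorization p = p * p ^ (M.factorization p - 1) := by
  rw [← pow_succ', Nat.sub_add_cancel (hp.factorization_pos_of_dvd hM hpM)]

theorem pow_factorization_mul (M p : ℕ) :
    p ^ M.factorization p * (M / p ^ M.factorization p) = M :=
  Nat.mul_div_cancel' (Nat.ordProj_dvd M p)

theorem pow_pred_mul (hp : p.Prime) (hM : M ≠ 0) (hpM : p ∣ M) :
    p ^ (M.factorization p - 1) * (M / p ^ M.factorization p) = M / p := by
  refine (Nat.div_eq_of_eq_mul_right hp.pos ?_).symm
  rw [← mul_assoc, ← pow_factorization_eq hp hM hpM, pow_factorization_mul]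

theorem coprime_pow_div (hp : p.Prime) (hM : M ≠ 0) (k : ℕ) :
    (p ^ k).Coprime (M / p ^ M.factorization p) :=
  (Nat.coprime_ordCompl hp hM).pow_left k

theorem arrayCoord_add (x y : ZMod M) :
    arrayCoord p (x + y) = arrayCoord p x + arrayCoord p y := by
  rw [arrayCoord, ZMod.cast_add (Nat.ordProj_dvd M p), add_mul, arrayCoord, arrayCoord]

theorem arrayCoord_sub (x y : ZMod M) :
    arrayCoord p (x - y) = arrayCoord p x - arrayCoord p y := by
  rw [arrayCoord, ZMod.cast_sub (Nat.ordProj_dvd M p), sub_mul, arrayCoord, arrayCoord]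

theorem isUnit_div (hp : p.Prime) (hM : M ≠ 0) :
    IsUnit ((M / p ^ M.factorization p : ℕ) : ZMod (p ^ M.factorization p)) := by
  rw [ZMod.isUnit_iff_coprime]
  exact (coprime_pow_div hp hM _).symm

theorem arrayCoord_mul (hp : p.Prime) (hM : M ≠ 0) (x : ZMod M) :
    arrayCoord p x * ((M / p ^ M.factorization p : ℕ) : ZMod (p ^ M.factorization p)) =
      x.cast := by
  rw [arrayCoord, mul_assoc, ZMod.inv_mul_of_unit _ (isUnit_div hp hM), mul_one]

theorem arrayCoord_surjective (hp : p.Prime) (hM : M ≠ 0) (c : ZMod (p ^ M.factorization p)) :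
    ∃ t : ZMod M, arrayCoord p t = c := by
  have : NeZero (p ^ M.factorization p) := ⟨pow_ne_zero _ hp.ne_zero⟩
  refine ⟨((c.val * (M / p ^ M.factorization p) : ℕ) : ZMod M), ?_⟩
  rw [arrayCoord, ZMod.cast_natCast (Nat.ordProj_dvd M p), Nat.cast_mul, ZMod.natCast_zmod_val,
    mul_assoc, ZMod.mul_inv_of_unit _ (isUnit_div hp hM), mul_one]

theorem pow_val_eq_pow_arrayCoord (hp : p.Prime) (hM : M ≠ 0) {θ : R}
    (hθ : θ ^ p ^ M.factorization p = 1) (x : ZMod M) :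
    θ ^ x.val = (θ ^ (M / p ^ M.factorization p)) ^ (arrayCoord p x).val := by
  have : NeZero M := ⟨hM⟩
  have : NeZero (p ^ M.factorization p) := ⟨pow_ne_zero _ hp.ne_zero⟩
  rw [← pow_mul]
  refine pow_val_eq_of_natCast_eq hθ ?_
  rw [Nat.cast_mul, ZMod.natCast_zmod_val, mul_comm, arrayCoord_mul hp hM, ZMod.natCast_val]

/-- The part of the exponential sum over `A` coming from `a` with array coordinate `c`. -/
def fiberSum (p : ℕ) (A : Finset (ZMod M)) (z : R) (c : ZMod (p ^ M.factorization p)) : R :=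
  ∑ a ∈ A with arrayCoord p a = c, z ^ a.val

theorem sum_fiberSum [NeZero (p ^ M.factorization p)] (A : Finset (ZMod M)) (z : R) :
    ∑ c, fiberSum p A z c = expSum A z :=
  sum_fiberwise A (arrayCoord p) (fun a => z ^ a.val)

theorem fiberSum_mul (hp : p.Prime) (hM : M ≠ 0) (A : Finset (ZMod M)) {θ : R}
    (hθ : θ ^ p ^ M.factorization p = 1) (z : R) (c : ZMod (p ^ M.factorization p)) :
    fiberSum p A (θ * z) c =
      (θ ^ (M / p ^ M.factorization p)) ^ c.val * fiberSum p A z c := by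
  rw [fiberSum, fiberSum, mul_sum]
  refine sum_congr rfl fun a ha => ?_
  rw [mul_pow, pow_val_eq_pow_arrayCoord hp hM hθ, (mem_filter.1 ha).2]

/-- Used with m = p and P = p^(n-1) to cut the coordinates into p windows of slab width. -/
theorem sum_range_window {E : Type*} [AddCommMonoid E] {Q m P : ℕ} [NeZero Q] (hQ : Q = m * P)
    (f : ZMod Q → E) :
    ∑ k ∈ range m, ∑ j ∈ range P, f (j + (k * P : ℕ)) = ∑ c, f c := by
  have h1 : ∀ g : ℕ → E, ∑ k ∈ range m, ∑ j ∈ range P, g (j + k * P) =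
      ∑ i ∈ range (m * P), g i := by
    intro g
    clear hQ
    induction m with
    | zero => simp
    | succ m ih =>
      rw [sum_range_succ, ih, Nat.succ_mul, sum_range_add]
      simp only [add_comm]
  have h2 := h1 (fun i => f (i : ZMod Q))
  simp only [Nat.cast_add] at h2
  rw [h2, ← hQ]
  clear h1 h2 hQ
  obtain ⟨n, rfl⟩ := Nat.exists_eq_succ_of_ne_zero (NeZero.ne Q)
  rw [← Fin.sum_univ_eq_sum_range (fun i => f (i : ZMod (n + 1)))]
  exact sum_congr rfl fun x _ => congrArg f (ZMod.natCast_zmod_val (n := n + 1) x)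

/-- Translation by t shifts coordinates by that of t, so varying t moves the window over all cyclic
positions. -/
theorem expSum_slab_translate (hp : p.Prime) (hM : M ≠ 0) (A : Finset (ZMod M))
    (t : ZMod M) {z : R} (hz : z ^ M = 1) :
    expSum (slab p (translate A t)) z = z ^ t.val *
      ∑ j ∈ range (p ^ (M.factorization p - 1)), fiberSum p A z (j - arrayCoord p t) := by
  have : NeZero M := ⟨hM⟩
  have : NeZero (p ^ M.factorization p) := ⟨pow_ne_zero _ hp.ne_zero⟩
  have hle : p ^ (M.factorization p - 1) ≤ p ^ M.factorization p :=
    Nat.pow_le_pow_right hp.pos (Nat.sub_le _ _)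
  rw [expSum, slab, sum_filter, translate, sum_image fun a _ b _ => add_right_cancel]
  simp only [fiberSum, sum_filter]
  rw [sum_comm, mul_sum]
  refine sum_congr rfl fun a _ => ?_
  rw [pow_val_add hz, arrayCoord_add]
  simp only [eq_sub_iff_add_eq]
  set u := arrayCoord p a + arrayCoord p t
  have key : ∀ j ∈ range (p ^ (M.factorization p - 1)), (u = (j : ZMod _) ↔ j = u.val) := by
    intro j hj
    constructor
    · intro h
      rw [h, ZMod.val_cast_of_lt ((mem_range.1 hj).trans_le hle)]
    · rintro rfl
      rw [ZMod.natCast_zmod_val]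
  rw [sum_congr rfl fun j hj => by rw [if_congr (key j hj) rfl rfl], sum_ite_eq']
  simp only [mem_range, mul_ite, mul_zero]
  rw [mul_comm]

theorem sum_shift_fiberSum [NeZero (p ^ M.factorization p)] (A : Finset (ZMod M)) (z : R)
    (u : ZMod (p ^ M.factorization p)) : ∑ c, fiberSum p A z (c - u) = expSum A z := by
  rw [← sum_fiberSum (p := p) A z]
  exact Fintype.sum_equiv (Equiv.subRight u) _ _ fun _ => rfl

/-! ### Slab tilings from the cyclotomic condition -/

/-- Slabs tile modulo `M / p` as soon as fibers at distance `p ^ (n - 1)` have the same product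
with `B` at all `M / p`-th roots of unity. -/
theorem slabTiling_of_fiberSum (hp : p.Prime) (hM : M ≠ 0) (hpM : p ∣ M) {A B : Finset (ZMod M)}
    (h : UniqueSums M A B)
    (hf : ∀ z : ℂ, z ^ (M / p) = 1 → ∀ c, fiberSum p A z c * expSum B z =
      fiberSum p A z (c + (p ^ (M.factorization p - 1) : ℕ)) * expSum B z) :
    SlabTiling p A B := by
  have : NeZero M := ⟨hM⟩
  have : NeZero (M / p) := ⟨(Nat.div_pos (Nat.le_of_dvd (Nat.pos_of_ne_zero hM) hpM) hp.pos).ne'⟩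
  have : NeZero (p ^ M.factorization p) := ⟨pow_ne_zero _ hp.ne_zero⟩
  intro t
  rw [isTilingMod_iff_uniqueSums]
  refine uniqueSums_of_expSum fun z hz => ?_
  have hzM : z ^ M = 1 := by rw [← Nat.div_mul_cancel hpM, pow_mul, hz, one_pow]
  set P := p ^ (M.factorization p - 1) with hP
  have hk : ∀ (k : ℕ) c, fiberSum p A z (c + (k * P : ℕ)) * expSum B z =
      fiberSum p A z c * expSum B z := by
    intro k c
    induction k with
    | zero => simp
    | succ k ih => rw [Nat.succ_mul, Nat.cast_add, ← add_assoc, ← hf z hz, ih]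
  -- By periodicity all p windows contribute equally.
  have key : (p : ℂ) * (expSum (slab p (translate A t)) z * expSum B z) =
      z ^ t.val * (expSum A z * expSum B z) := by
    rw [expSum_slab_translate hp hM A t hzM, ← sum_shift_fiberSum (p := p) A z (arrayCoord p t),
      ← sum_range_window (pow_factorization_eq hp hM hpM), ← hP, sum_mul]
    have : ∀ k ∈ range p, (∑ j ∈ range P, fiberSum p A z
        ((j : ZMod (p ^ M.factorization p)) + (k * P : ℕ) - arrayCoord p t)) * expSum B z =
        (∑ j ∈ range P, fiberSum p A z ((j : ZMod (p ^ M.factorization p)) - arrayCoord p t)) * expSum B z := by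
      intro k _
      rw [sum_mul, sum_mul]
      refine sum_congr rfl fun j _ => ?_
      rw [add_sub_right_comm, hk k]
    rw [sum_congr rfl this, sum_const, card_range, nsmul_eq_mul]
    ring
  have hp0 : (p : ℂ) ≠ 0 := Nat.cast_ne_zero.2 hp.ne_zero
  rw [h.expSum_mul hzM] at key
  refine mul_left_cancel₀ hp0 (key.trans ?_)
  by_cases h1 : z = 1
  · rw [h1, one_pow, expSum_one, expSum_one, card_univ, card_univ, ZMod.card, ZMod.card, one_mul,
      ← Nat.cast_mul, Nat.mul_div_cancel' hpM]
  · rw [expSum_univ_eq_zero hzM h1, expSum_univ_eq_zero hz h1, mul_zero, mul_zero]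

/-- An `m * n`-th root of unity, with `m` and `n` coprime, is a product of an `m`-th and an
`n`-th root of unity. -/
theorem exists_mul_of_pow_eq_one {m n : ℕ} (hmn : m.Coprime n) {z : ℂ} (hz0 : z ≠ 0)
    (hz : z ^ (m * n) = 1) : ∃ θ ζ : ℂ, θ ^ m = 1 ∧ ζ ^ n = 1 ∧ z = θ * ζ := by
  have hb := Nat.gcd_eq_gcd_ab m n
  rw [hmn.gcd_eq_one, Nat.cast_one] at hb
  have hz' : z ^ ((m : ℤ) * n) = 1 := by exact_mod_cast hz
  refine ⟨z ^ (n * Nat.gcdB m n), z ^ (m * Nat.gcdA m n), ?_, ?_, ?_⟩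
  · rw [← zpow_natCast, ← zpow_mul,
      show (n : ℤ) * Nat.gcdB m n * m = m * n * Nat.gcdB m n by ring, zpow_mul, hz', one_zpow]
  · rw [← zpow_natCast, ← zpow_mul,
      show (m : ℤ) * Nat.gcdA m n * n = m * n * Nat.gcdA m n by ring, zpow_mul, hz', one_zpow]
  · rw [← zpow_add₀ hz0, add_comm, ← hb, zpow_one]

theorem isPrimitiveRoot_mul {θ ζ : ℂ} {m n : ℕ} (hθ : IsPrimitiveRoot θ m)
    (hζ : IsPrimitiveRoot ζ n) (hmn : m.Coprime n) : IsPrimitiveRoot (θ * ζ) (m * n) := by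
  rw [IsPrimitiveRoot.iff_orderOf, (Commute.all θ ζ).orderOf_mul_eq_mul_orderOf_of_coprime,
    ← hθ.eq_orderOf, ← hζ.eq_orderOf]
  rwa [← hθ.eq_orderOf, ← hζ.eq_orderOf]

/-- A function on `ℤ_{p^n}` whose Fourier transform vanishes at primitive `p^n`-th roots of unity
is `p^{n-1}`-periodic. -/
theorem eq_add_of_sum_eq_zero {Q P : ℕ} [NeZero Q] (hp : p.Prime) (hQ : Q = p * P)
    {n : ℕ} (hP : P = p ^ n) (g : ZMod Q → ℂ)
    (hg : ∀ η : ℂ, IsPrimitiveRoot η Q → ∑ c, g c * η ^ c.val = 0) (c : ZMod Q) :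
    g c = g (c + (P : ZMod Q)) := by
  have h0 := sum_pow_val_eq_zero (fun c => g (c + (P : ZMod Q)) - g c) (by
    intro η hη
    have hshift : η ^ P * ∑ c, g (c + (P : ZMod Q)) * η ^ c.val = ∑ c, g c * η ^ c.val := by
      rw [mul_sum]
      refine Fintype.sum_equiv (Equiv.addRight (P : ZMod Q)) _ _ fun x => ?_
      rw [Equiv.coe_addRight, pow_val_add hη, pow_val_natCast hη]
      ring
    simp only [sub_mul, sum_sub_distrib]
    -- At primitive η both transforms vanish; at any other Q-th root η^P = 1, and the shift by P is
    -- invisible.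
    by_cases hprim : IsPrimitiveRoot η Q
    · rw [hg η hprim] at hshift ⊢
      have hη0 : η ≠ 0 := hprim.ne_zero (NeZero.ne Q)
      rw [(mul_eq_zero.1 hshift).resolve_left (pow_ne_zero _ hη0), sub_zero]
    · have h1 : η ^ P = 1 := by
        have hord : orderOf η ∣ p ^ (n + 1) := by
          rw [pow_succ', ← hP, ← hQ]
          exact orderOf_dvd_of_pow_eq_one hη
        obtain ⟨k, hk, hk'⟩ := (Nat.dvd_prime_pow hp).1 hord
        have hkn : k ≤ n := by
          by_contra hlt
          refine hprim (IsPrimitiveRoot.iff_orderOf.2 ?_)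
          rw [hk', show k = n + 1 by omega, hQ, hP, pow_succ']
        rw [← orderOf_dvd_iff_pow_eq_one, hk', hP]
        exact pow_dvd_pow p hkn
      rw [h1, one_mul] at hshift
      rw [hshift, sub_self])
  exact (sub_eq_zero.1 (congrFun h0 c)).symm

/-- Compensates for the factor M_p in x ≡ π_p(x) M_p: raising to a unit power permutes the primitive
roots. -/
theorem exists_primitiveRoot_pow_eq {Q W : ℕ} [NeZero Q] (hW : IsUnit (W : ZMod Q)) {η : ℂ}
    (hη : IsPrimitiveRoot η Q) : ∃ θ : ℂ, IsPrimitiveRoot θ Q ∧ θ ^ W = η := by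
  obtain ⟨u, hu⟩ := hW
  refine ⟨η ^ ((u⁻¹ : (ZMod Q)ˣ) : ZMod Q).val,
    hη.pow_of_coprime _ (ZMod.val_coe_unit_coprime u⁻¹), ?_⟩
  rw [← pow_mul]
  refine (pow_val_eq_of_natCast_eq hη.pow_eq_one (l := 1) ?_).trans (pow_one η)
  rw [Nat.cast_mul, ZMod.natCast_zmod_val, ← hu, Units.inv_mul, Nat.cast_one]

theorem expSum_mul_eq_sum_fiberSum [NeZero (p ^ M.factorization p)] (hp : p.Prime) (hM : M ≠ 0)
    (A : Finset (ZMod M)) {θ : ℂ} (hθ : θ ^ p ^ M.factorization p = 1) (z : ℂ) :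
    expSum A (θ * z) =
      ∑ c, fiberSum p A z c * (θ ^ (M / p ^ M.factorization p)) ^ c.val := by
  rw [← sum_fiberSum (p := p)]
  refine sum_congr rfl fun c _ => ?_
  rw [fiberSum_mul hp hM A hθ, mul_comm]

/-- If θ is a primitive p^n-th root, θζ has order p^n d, where A vanishes. So the Fourier transform
of the fibers vanishes at all primitive p^n-th roots. -/
theorem fiberSum_eq_of_cyclotomic_dvd (hp : p.Prime) (hM : M ≠ 0) (hpM : p ∣ M)
    {A : Finset (ZMod M)} {d : ℕ} (hd : d ∣ M / p ^ M.factorization p) {ζ : ℂ}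
    (hζ : IsPrimitiveRoot ζ d) (hA : cyclotomic (p ^ M.factorization p * d) ℤ ∣ mask A)
    (c : ZMod (p ^ M.factorization p)) :
    fiberSum p A ζ c = fiberSum p A ζ (c + (p ^ (M.factorization p - 1) : ℕ)) := by
  have hQ0 : p ^ M.factorization p ≠ 0 := pow_ne_zero _ hp.ne_zero
  have : NeZero (p ^ M.factorization p) := ⟨hQ0⟩
  have hd0 : d ≠ 0 := by
    rintro rfl
    rw [zero_dvd_iff] at hd
    exact hM (by rw [← pow_factorization_mul M p, hd, mul_zero])
  refine eq_add_of_sum_eq_zero hp (pow_factorization_eq hp hM hpM) rfl (fiberSum p A ζ) ?_ c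
  intro η hη
  obtain ⟨θ, hθ, rfl⟩ := exists_primitiveRoot_pow_eq (isUnit_div hp hM) hη
  rw [← expSum_mul_eq_sum_fiberSum hp hM A hθ.pow_eq_one]
  exact (cyclotomic_dvd_mask_iff (mul_ne_zero hQ0 hd0)
    (isPrimitiveRoot_mul hθ hζ ((coprime_pow_div hp hM _).coprime_dvd_right hd)) A).1 hA

theorem SlabCyclotomic.slabTiling (hp : p.Prime) (hM : M ≠ 0) (hpM : p ∣ M)
    {A B : Finset (ZMod M)} (h : UniqueSums M A B) (hs : SlabCyclotomic p A B) :
    SlabTiling p A B := by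
  have hQ0 : p ^ M.factorization p ≠ 0 := pow_ne_zero _ hp.ne_zero
  have : NeZero (p ^ M.factorization p) := ⟨hQ0⟩
  refine slabTiling_of_fiberSum hp hM hpM h fun z hz c => ?_
  have hN0 : M / p ≠ 0 := (Nat.div_pos (Nat.le_of_dvd (Nat.pos_of_ne_zero hM) hpM) hp.pos).ne'
  have hz0 : z ≠ 0 := by
    rintro rfl
    rw [zero_pow hN0] at hz
    exact zero_ne_one hz
  rw [← pow_pred_mul hp hM hpM] at hz
  obtain ⟨θ, ζ, hθ, hζ, rfl⟩ := exists_mul_of_pow_eq_one (coprime_pow_div hp hM _) hz0 hz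
  have hd : orderOf ζ ∣ M / p ^ M.factorization p := orderOf_dvd_of_pow_eq_one hζ
  have hζd := IsPrimitiveRoot.orderOf ζ
  have hDM : p ^ M.factorization p * orderOf ζ ∣ M := by
    conv_rhs => rw [← pow_factorization_mul M p]
    exact mul_dvd_mul_left _ hd
  have hd0 : orderOf ζ ≠ 0 := right_ne_zero_of_mul (ne_zero_of_dvd_ne_zero hM hDM)
  rcases hs _ (dvd_mul_right _ _) hDM with hA | hB
  -- The fibers at ζ are periodic, and the character introduced by θ is too because θ^(p^(n-1)) = 1.
  · have hθQ : θ ^ p ^ M.factorization p = 1 := by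
      rw [pow_factorization_eq hp hM hpM, mul_comm, pow_mul, hθ, one_pow]
    have hθW : (θ ^ (M / p ^ M.factorization p)) ^ p ^ M.factorization p = 1 := by
      rw [← pow_mul, mul_comm, pow_mul, hθQ, one_pow]
    rw [fiberSum_mul hp hM A hθQ, fiberSum_mul hp hM A hθQ, pow_val_add hθW,
      pow_val_natCast hθW, ← pow_mul _ _ (p ^ (M.factorization p - 1)),
      mul_comm _ (p ^ (M.factorization p - 1)), pow_mul _ (p ^ (M.factorization p - 1)), hθ,
      one_pow, mul_one, ← fiberSum_eq_of_cyclotomic_dvd hp hM hpM hd hζd hA]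
  -- θ has order p^β with β ≤ n - 1, so the factor with α = n - β makes B vanish at θζ.
  · obtain ⟨β, hβ, hβ'⟩ := (Nat.dvd_prime_pow hp).1 (orderOf_dvd_of_pow_eq_one hθ)
    have hn := hp.factorization_pos_of_dvd hM hpM
    have hdiv : p ^ M.factorization p * orderOf ζ / p ^ (M.factorization p - β) =
        p ^ β * orderOf ζ := by
      refine Nat.div_eq_of_eq_mul_right (pow_pos hp.pos _) ?_
      rw [← mul_assoc, ← pow_add, Nat.sub_add_cancel (by omega)]
    have hmem : M.factorization p - β ∈ Icc 1 (M.factorization p) := by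
      rw [mem_Icc]
      omega
    have h1 := (dvd_prod_of_mem (fun α => cyclotomic
      (p ^ M.factorization p * orderOf ζ / p ^ α) ℤ) hmem).trans hB
    rw [hdiv, cyclotomic_dvd_mask_iff (mul_ne_zero (pow_ne_zero _ hp.ne_zero) hd0)
      (isPrimitiveRoot_mul (hβ' ▸ IsPrimitiveRoot.orderOf θ) hζd
        ((coprime_pow_div hp hM _).coprime_dvd_right hd))] at h1
    rw [h1, mul_zero, mul_zero]

/-! ### Slab tilings from the divisor condition -/

theorem eq_of_val_lt_of_cast_sub_eq_zero {Q P : ℕ} [NeZero Q] (hPQ : P ∣ Q) {c c' : ZMod Q}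
    (hc : c.val < P) (hc' : c'.val < P) (h : ((c - c').cast : ZMod P) = 0) : c = c' := by
  have hP : NeZero P := ⟨(Nat.zero_lt_of_lt hc).ne'⟩
  rw [ZMod.cast_sub hPQ, sub_eq_zero, ZMod.cast_eq_val, ZMod.cast_eq_val,
    ZMod.natCast_eq_natCast_iff', Nat.mod_eq_of_lt hc, Nat.mod_eq_of_lt hc'] at h
  exact ZMod.val_injective Q h

theorem gcd_prime_pow_eq_of_not_dvd (hp : p.Prime) {n x : ℕ} (h : ¬ p ^ (n - 1) ∣ x) :
    Nat.gcd x (p ^ n) = Nat.gcd x (p ^ (n - 1)) := by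
  refine Nat.dvd_antisymm (Nat.dvd_gcd (Nat.gcd_dvd_left _ _) ?_)
    (Nat.dvd_gcd (Nat.gcd_dvd_left _ _)
      ((Nat.gcd_dvd_right _ _).trans (pow_dvd_pow p (Nat.sub_le n 1))))
  obtain ⟨k, -, hk⟩ := (Nat.dvd_prime_pow hp).1 (Nat.gcd_dvd_right x (p ^ n))
  rw [hk]
  refine pow_dvd_pow p ?_
  by_contra hlt
  exact h ((pow_dvd_pow p (by omega)).trans (hk ▸ Nat.gcd_dvd_left x (p ^ n)))

theorem gcd_prime_pow_of_dvd (hp : p.Prime) {n x : ℕ} (hn : 0 < n) (h : p ^ (n - 1) ∣ x)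
    (h' : ¬ p ^ n ∣ x) : Nat.gcd x (p ^ n) = p ^ (n - 1) := by
  obtain ⟨k, hkn, hk⟩ := (Nat.dvd_prime_pow hp).1 (Nat.gcd_dvd_right x (p ^ n))
  have h1 : k ≠ n := by
    rintro rfl
    exact h' (hk ▸ Nat.gcd_dvd_left _ _)
  have h2 : p ^ (n - 1) ∣ p ^ k := hk ▸ Nat.dvd_gcd h (pow_dvd_pow p (Nat.sub_le n 1))
  have h3 := (Nat.pow_dvd_pow_iff_le_right hp.one_lt).1 h2
  rw [hk, show k = n - 1 by omega]

/-- a - a' and b' - b agree modulo M/p, so their gcds with M can differ only if p^(n-1) divides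
both. Then the slab width forces p^n ∣ a - a'. With m = gcd(a - a', M), the other gcd is m or m/p;
the hypothesis excludes m/p, and equality of gcds is settled by `UniqueSums.eq_of_gcd_eq`. -/
theorem SlabDivisor.eq_of_add_eq (hp : p.Prime) (hM : M ≠ 0) (hpM : p ∣ M)
    {A B : Finset (ZMod M)} (h : UniqueSums M A B) (hs : SlabDivisor p A B) {t : ZMod M}
    {a a' b b' : ZMod M} (ha : a ∈ A) (ha' : a' ∈ A) (hb : b ∈ B) (hb' : b' ∈ B)
    (hat : (arrayCoord p (a + t)).val < p ^ (M.factorization p - 1))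
    (hat' : (arrayCoord p (a' + t)).val < p ^ (M.factorization p - 1))
    (hab : (a.cast + b.cast : ZMod (M / p)) = a'.cast + b'.cast) : a = a' ∧ b = b' := by
  have : NeZero M := ⟨hM⟩
  have hn := hp.factorization_pos_of_dvd hM hpM
  set n := M.factorization p with hn'
  set W := M / p ^ n with hW
  have hM' : M = p ^ n * W := (pow_factorization_mul M p).symm
  have hN' : M / p = p ^ (n - 1) * W := (pow_pred_mul hp hM hpM).symm
  have : NeZero (p ^ n) := ⟨pow_ne_zero _ hp.ne_zero⟩
  have hcop : ∀ k, (p ^ k).Coprime W := coprime_pow_div hp hM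
  have hgM : ∀ x, Nat.gcd x M = Nat.gcd x (p ^ n) * Nat.gcd x W := fun x => by
    conv_lhs => rw [hM']
    exact (hcop n).gcd_mul x
  have hmod : (a - a').val ≡ (b' - b).val [MOD M / p] := by
    rw [← ZMod.natCast_eq_natCast_iff, ZMod.natCast_val, ZMod.natCast_val,
      ZMod.cast_sub (Nat.div_dvd_of_dvd hpM), ZMod.cast_sub (Nat.div_dvd_of_dvd hpM)]
    linear_combination hab
  have hmodP : (a - a').val ≡ (b' - b).val [MOD p ^ (n - 1)] := hmod.of_dvd ⟨W, hN'⟩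
  have hmodW : (a - a').val ≡ (b' - b).val [MOD W] :=
    hmod.of_dvd ⟨p ^ (n - 1), hN'.trans (mul_comm _ _)⟩
  have hgcd : Nat.gcd (a - a').val (p ^ n) = Nat.gcd (b' - b).val (p ^ n) →
      a = a' ∧ b = b' := by
    intro hg
    have := h.eq_of_gcd_eq ha ha' hb' hb (by rw [hgM, hgM, hg, hmodW.gcd_eq])
    exact ⟨this.1, this.2.symm⟩
  by_cases hP : p ^ (n - 1) ∣ (a - a').val
  · have hP' : p ^ (n - 1) ∣ (b' - b).val := (hmodP.dvd_iff dvd_rfl).1 hP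
    have hPQ : p ^ (n - 1) ∣ p ^ n := pow_dvd_pow p (Nat.sub_le n 1)
    have h0 : arrayCoord p (a + t) = arrayCoord p (a' + t) := by
      refine eq_of_val_lt_of_cast_sub_eq_zero hPQ hat hat' ?_
      rw [← arrayCoord_sub, add_sub_add_right_eq_sub, arrayCoord, ZMod.cast_mul hPQ,
        ZMod.cast_eq_val (a - a'), ZMod.cast_natCast hPQ, (ZMod.natCast_eq_zero_iff _ _).2 hP,
        zero_mul]
    have hQ : p ^ n ∣ (a - a').val := by
      rw [← ZMod.natCast_eq_zero_iff, ZMod.natCast_val, ← arrayCoord_mul hp hM,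
        ← add_sub_add_right_eq_sub a a' t, arrayCoord_sub, h0, sub_self, zero_mul]
    by_cases hQ' : p ^ n ∣ (b' - b).val
    · exact hgcd (by rw [Nat.gcd_eq_right hQ, Nat.gcd_eq_right hQ'])
    · refine absurd ⟨b', hb', b, hb, ?_⟩ (hs (Nat.gcd (a - a').val M)
        (Nat.dvd_gcd hQ (Nat.ordProj_dvd M p)) (Nat.gcd_dvd_right _ _) ⟨a, ha, a', ha', rfl⟩)
      rw [hgM, hgM, gcd_prime_pow_of_dvd hp hn hP' hQ', Nat.gcd_eq_right hQ, hmodW.gcd_eq]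
      refine Nat.div_eq_of_eq_mul_right hp.pos ?_
      rw [← mul_assoc, ← pow_succ', Nat.sub_add_cancel hn]
  · have hP' : ¬ p ^ (n - 1) ∣ (b' - b).val := fun hd => hP ((hmodP.dvd_iff dvd_rfl).2 hd)
    exact hgcd (by rw [gcd_prime_pow_eq_of_not_dvd hp hP, gcd_prime_pow_eq_of_not_dvd hp hP',
      hmodP.gcd_eq])

theorem mem_slab_translate {A : Finset (ZMod M)} {t x : ZMod M} :
    x ∈ slab p (translate A t) ↔
      ∃ a ∈ A, a + t = x ∧ (arrayCoord p x).val < p ^ (M.factorization p - 1) := by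
  simp only [slab, translate, mem_filter, mem_image]
  grind

theorem sum_card_slab_translate (hp : p.Prime) (hM : M ≠ 0) (hpM : p ∣ M)
    (A : Finset (ZMod M)) (u : ZMod (p ^ M.factorization p)) (t : ℕ → ZMod M)
    (ht : ∀ k, arrayCoord p (t k) = u - (k * p ^ (M.factorization p - 1) : ℕ)) :
    ∑ k ∈ range p, #(slab p (translate A (t k))) = #A := by
  have : NeZero (p ^ M.factorization p) := ⟨pow_ne_zero _ hp.ne_zero⟩
  have h1 : ∀ k, (#(slab p (translate A (t k))) : ℤ) =
      ∑ j ∈ range (p ^ (M.factorization p - 1)), fiberSum p A (1 : ℤ)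
        ((j : ZMod (p ^ M.factorization p)) + (k * p ^ (M.factorization p - 1) : ℕ) - u) := by
    intro k
    rw [← expSum_one (R := ℤ), expSum_slab_translate hp hM A (t k) (one_pow M), one_pow, one_mul,
      ht]
    refine sum_congr rfl fun j _ => ?_
    rw [sub_sub_eq_add_sub]
  have h2 := sum_range_window (pow_factorization_eq hp hM hpM)
    (fun c => fiberSum p A (1 : ℤ) (c - u))
  rw [sum_shift_fiberSum, expSum_one] at h2
  simp only [← h1] at h2
  exact_mod_cast h2

theorem SlabDivisor.slabTiling (hp : p.Prime) (hM : M ≠ 0) (hpM : p ∣ M)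
    {A B : Finset (ZMod M)} (h : UniqueSums M A B) (hs : SlabDivisor p A B) :
    SlabTiling p A B := by
  have : NeZero M := ⟨hM⟩
  have : NeZero (M / p) := ⟨(Nat.div_pos (Nat.le_of_dvd (Nat.pos_of_ne_zero hM) hpM) hp.pos).ne'⟩
  have hinj : ∀ t : ZMod M, ∀ x ∈ slab p (translate A t), ∀ x' ∈ slab p (translate A t),
      ∀ b ∈ B, ∀ b' ∈ B, (x.cast + b.cast : ZMod (M / p)) = x'.cast + b'.cast →
      x = x' ∧ b = b' := by
    intro t x hx x' hx' b hb b' hb' hxb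
    obtain ⟨a, ha, rfl, hat⟩ := mem_slab_translate.1 hx
    obtain ⟨a', ha', rfl, hat'⟩ := mem_slab_translate.1 hx'
    have := hs.eq_of_add_eq hp hM hpM h ha ha' hb hb' hat hat' (by
      rw [ZMod.cast_add (Nat.div_dvd_of_dvd hpM), ZMod.cast_add (Nat.div_dvd_of_dvd hpM)] at hxb
      linear_combination hxb)
    exact ⟨by rw [this.1], this.2⟩
  -- Injectivity bounds each of p complementary slabs by M/p, while together they contribute |A||B|
  -- = M; hence every bound is an equality.
  have hle : ∀ t : ZMod M, #(slab p (translate A t)) * #B ≤ M / p := by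
    intro t
    rw [← card_product, ← ZMod.card (M / p), ← card_univ]
    refine card_le_card_of_injOn (fun ab => (ab.1.cast + ab.2.cast : ZMod (M / p)))
      (fun _ _ => mem_coe.2 (mem_univ _)) ?_
    intro x hx y hy hxy
    rw [mem_coe, mem_product] at hx hy
    exact Prod.ext_iff.2 (hinj t _ hx.1 _ hy.1 _ hx.2 _ hy.2 hxy)
  intro t
  rw [isTilingMod_iff_uniqueSums]
  refine uniqueSums_of_card_mul ?_ (hinj t)
  have hex : ∀ k : ℕ, ∃ s : ZMod M, arrayCoord p s =
      arrayCoord p t - (k * p ^ (M.factorization p - 1) : ℕ) :=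
    fun k => arrayCoord_surjective hp hM _
  choose s hs' using hex
  -- The update makes the translate of index 0 the given t itself, rather than another element with
  -- the same coordinate.
  have hs0 : ∀ k, arrayCoord p (Function.update s 0 t k) =
      arrayCoord p t - (k * p ^ (M.factorization p - 1) : ℕ) := by
    intro k
    by_cases hk : k = 0
    · subst hk
      simp
    · rw [Function.update_of_ne hk, hs']
  have hsum := congrArg (· * #B) (sum_card_slab_translate hp hM hpM A _ _ hs0)
  simp only [sum_mul] at hsum
  rw [h.card_mul] at hsum
  have hconst : ∑ k ∈ range p, (M / p) = M := by
    rw [sum_const, card_range, smul_eq_mul, Nat.mul_div_cancel' hpM]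
  have := (sum_eq_sum_iff_of_le fun k _ => hle (Function.update s 0 t k)).1
    (hsum.trans hconst.symm) 0 (mem_range.2 hp.pos)
  simpa using this

/-! ### From slab tilings to (T2) -/

theorem primePow_dvd_div_of_dvd (hp : p.Prime) (hM : M ≠ 0) (hpM : p ∣ M) {s : ℕ}
    (hs : IsPrimePow s) (hsM : s ∣ M) (hne : s ≠ p ^ M.factorization p) : s ∣ M / p := by
  obtain ⟨q, k, hq, -, rfl⟩ := hs
  by_cases hqp : q = p
  · subst hqp
    have hk := (hp.pow_dvd_iff_le_factorization hM).1 hsM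
    have hk' : k ≠ M.factorization q := fun h => hne (by rw [h])
    rw [← pow_pred_mul hp hM hpM]
    exact (pow_dvd_pow q (by omega)).mul_right _
  · have hc : (q ^ k).Coprime p := ((Nat.coprime_primes hq.nat_prime hp).2 hqp).pow_left k
    refine hc.dvd_of_dvd_mul_left ?_
    rwa [Nat.mul_div_cancel' hpM]

theorem prod_dvd_of_coprime_nat {S : Finset ℕ} {N : ℕ}
    (hc : ∀ s ∈ S, ∀ t ∈ S, s ≠ t → Nat.Coprime s t) (h : ∀ s ∈ S, s ∣ N) :
    ∏ s ∈ S, s ∣ N :=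
  prod_dvd_of_isRelPrime (fun s hs t ht hst => Nat.coprime_iff_isRelPrime.1 (hc s hs t ht hst)) h

theorem cyclotomic_dvd_mask_reduceMod_iff [NeZero M] {N : ℕ} {A : Finset (ZMod M)}
    (hA : Set.InjOn (fun a : ZMod M => (a.cast : ZMod N)) (A : Set (ZMod M))) {d : ℕ}
    (hN : N ≠ 0) (hd : d ∣ N) :
    cyclotomic d ℤ ∣ mask (reduceMod N A) ↔ cyclotomic d ℤ ∣ mask A := by
  have hd0 := ne_zero_of_dvd_ne_zero hN hd
  have hz := Complex.isPrimitiveRoot_exp d hd0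
  rw [cyclotomic_dvd_mask_iff hd0 hz, cyclotomic_dvd_mask_iff hd0 hz,
    expSum_reduceMod hA ((hz.pow_eq_one_iff_dvd N).2 hd)]

/-- The reduction of a slab tiling modulo `M / p` consists of sets satisfying (T2), hence
products of prime power cyclotomic factors of the slabs and of `B` behave as (T2) predicts. -/
theorem SlabTiling.cyclotomic_prod_dvd (hp : p.Prime) (hM : M ≠ 0) (hpM : p ∣ M)
    {A B : Finset (ZMod M)} (hAB : UniqueSums M A B)
    (hT2 : ∀ A' B' : Finset (ZMod (M / p)), IsTiling A' B' →
      p * #A' = #A → #B' = #B → SatisfiesT2 A' ∧ SatisfiesT2 B')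
    (hs : SlabTiling p A B) (t : ZMod M) {S : Finset ℕ} (hS : S.Nonempty)
    (hSN : ∀ s ∈ S, s ∣ M / p) (hpp : ∀ s ∈ S, IsPrimePow s)
    (hc : ∀ s ∈ S, ∀ t ∈ S, s ≠ t → Nat.Coprime s t) :
    ((∀ s ∈ S, cyclotomic s ℤ ∣ mask A) →
      cyclotomic (∏ s ∈ S, s) ℤ ∣ mask (slab p (translate A t))) ∧
    ((∀ s ∈ S, cyclotomic s ℤ ∣ mask B) → cyclotomic (∏ s ∈ S, s) ℤ ∣ mask B) := by
  have : NeZero M := ⟨hM⟩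
  have hN : M / p ≠ 0 := (Nat.div_pos (Nat.le_of_dvd (Nat.pos_of_ne_zero hM) hpM) hp.pos).ne'
  have : NeZero (M / p) := ⟨hN⟩
  have hU := isTilingMod_iff_uniqueSums.1 (hs t)
  obtain ⟨hiA, hiB, htile⟩ := hs t
  have hB0 : 0 < #B := Nat.pos_of_mul_pos_left (hAB.card_mul ▸ Nat.pos_of_ne_zero hM)
  have hcardA : p * #(reduceMod (M / p) (slab p (translate A t))) = #A := by
    rw [reduceMod, card_image_of_injOn hiA]
    refine Nat.eq_of_mul_eq_mul_right hB0 ?_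
    rw [hAB.card_mul, mul_assoc, hU.card_mul, Nat.mul_div_cancel' hpM]
  obtain ⟨h1, h2⟩ := hT2 _ _ htile hcardA (by rw [reduceMod, card_image_of_injOn hiB])
  have hprod := prod_dvd_of_coprime_nat hc hSN
  constructor
  · intro hA
    rw [← cyclotomic_dvd_mask_reduceMod_iff hiA hN hprod]
    refine h1 S hS (fun s hs => ⟨hpp s hs, ?_⟩) hc
    rw [cyclotomic_dvd_mask_reduceMod_iff hiA hN (hSN s hs)]
    -- Φ_s divides A, hence not B, so in the tiling modulo M/p it must divide the slab.
    exact (hU.cyclotomic_dvd (hSN s hs) (hpp s hs).ne_one).resolve_right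
      (hAB.primePowerDivisors (hpp s hs) (hA s hs)).2
  · intro hB
    rw [← cyclotomic_dvd_mask_reduceMod_iff hiB hN hprod]
    refine h2 S hS (fun s hs => ⟨hpp s hs, ?_⟩) hc
    rw [cyclotomic_dvd_mask_reduceMod_iff hiB hN (hSN s hs)]
    exact hB s hs

theorem sum_window_eq_zero (hp : p.Prime) (hM : M ≠ 0) {A : Finset (ZMod M)} {d : ℕ}
    (hd : d ∣ M) {ζ : ℂ} (hζ : IsPrimitiveRoot ζ d)
    (h : ∀ t : ZMod M, cyclotomic d ℤ ∣ mask (slab p (translate A t)))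
    (c : ZMod (p ^ M.factorization p)) :
    ∑ j ∈ range (p ^ (M.factorization p - 1)), fiberSum p A ζ (j + c) = 0 := by
  obtain ⟨t, ht⟩ := arrayCoord_surjective hp hM (-c)
  have hd0 := ne_zero_of_dvd_ne_zero hM hd
  have h1 := (cyclotomic_dvd_mask_iff hd0 hζ _).1 (h t)
  rw [expSum_slab_translate hp hM A t ((hζ.pow_eq_one_iff_dvd M).2 hd), ht, mul_eq_zero] at h1
  simp only [sub_neg_eq_add] at h1
  exact h1.resolve_left (pow_ne_zero _ (hζ.ne_zero hd0))

theorem cyclotomic_dvd_mask_of_slab (hp : p.Prime) (hM : M ≠ 0) (hpM : p ∣ M)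
    {A : Finset (ZMod M)} {d : ℕ} (hd : d ∣ M)
    (h : ∀ t : ZMod M, cyclotomic d ℤ ∣ mask (slab p (translate A t))) :
    cyclotomic d ℤ ∣ mask A := by
  have : NeZero (p ^ M.factorization p) := ⟨pow_ne_zero _ hp.ne_zero⟩
  have hd0 := ne_zero_of_dvd_ne_zero hM hd
  have hζ := Complex.isPrimitiveRoot_exp d hd0
  rw [cyclotomic_dvd_mask_iff hd0 hζ, ← sum_fiberSum (p := p),
    ← sum_range_window (pow_factorization_eq hp hM hpM)]
  exact sum_eq_zero fun k _ => sum_window_eq_zero hp hM hd hζ h _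

theorem cyclotomic_mul_dvd_mask_of_slab (hp : p.Prime) (hM : M ≠ 0) (hpM : p ∣ M)
    {A : Finset (ZMod M)} {d : ℕ} (hd : d ∣ M / p ^ M.factorization p)
    (h : ∀ t : ZMod M, cyclotomic d ℤ ∣ mask (slab p (translate A t))) :
    cyclotomic (p ^ M.factorization p * d) ℤ ∣ mask A := by
  have hQ0 : p ^ M.factorization p ≠ 0 := pow_ne_zero _ hp.ne_zero
  have : NeZero (p ^ M.factorization p) := ⟨hQ0⟩
  have hdM : d ∣ M := hd.trans (Nat.div_dvd_of_dvd (Nat.ordProj_dvd M p))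
  have hd0 := ne_zero_of_dvd_ne_zero hM hdM
  have hζ := Complex.isPrimitiveRoot_exp d hd0
  set ζ := Complex.exp (2 * Real.pi * Complex.I / d)
  have hη := Complex.isPrimitiveRoot_exp _ hQ0
  obtain ⟨θ, hθ, hθη⟩ := exists_primitiveRoot_pow_eq (isUnit_div hp hM) hη
  rw [cyclotomic_dvd_mask_iff (mul_ne_zero hQ0 hd0)
    (isPrimitiveRoot_mul hθ hζ ((coprime_pow_div hp hM _).coprime_dvd_right hd)),
    expSum_mul_eq_sum_fiberSum hp hM A hθ.pow_eq_one, hθη]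
  set η := Complex.exp (2 * Real.pi * Complex.I / (p ^ M.factorization p : ℕ))
  set P := p ^ (M.factorization p - 1) with hP
  -- The windows starting at c and c + 1 both sum to zero, and they differ only in the fibers c and
  -- c + P.
  have hper : ∀ c, fiberSum p A ζ (c + (P : ZMod (p ^ M.factorization p))) =
      fiberSum p A ζ c := by
    intro c
    have h1 := sum_range_succ (fun j : ℕ => fiberSum p A ζ (j + c)) P
    rw [sum_range_succ', sum_window_eq_zero hp hM hdM hζ h] at h1
    have h2 := sum_window_eq_zero hp hM hdM hζ h (1 + c)
    simp only [← hP, ← add_assoc] at h2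
    simp only [Nat.cast_add, Nat.cast_one, h2, zero_add, Nat.cast_zero] at h1
    rw [add_comm c, h1]
  -- A nonzero sum would force η^P = 1, impossible for η of order p^n with P = p^(n-1).
  have hshift : η ^ P * ∑ c, fiberSum p A ζ c * η ^ c.val = ∑ c, fiberSum p A ζ c * η ^ c.val := by
    rw [mul_sum]
    refine Fintype.sum_equiv (Equiv.addRight (P : ZMod (p ^ M.factorization p))) _ _ fun c => ?_
    rw [Equiv.coe_addRight, pow_val_add hη.pow_eq_one, pow_val_natCast hη.pow_eq_one, hper]
    ring
  by_contra hne
  have hdvd := (hη.pow_eq_one_iff_dvd P).1 ((mul_eq_right₀ hne).1 hshift)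
  have := (Nat.pow_dvd_pow_iff_le_right hp.one_lt).1 hdvd
  have := hp.factorization_pos_of_dvd hM hpM
  omega

theorem SlabTiling.satisfiesT2 (hp : p.Prime) (hM : M ≠ 0) (hpM : p ∣ M)
    {A B : Finset (ZMod M)} (hAB : UniqueSums M A B)
    (hT2 : ∀ A' B' : Finset (ZMod (M / p)), IsTiling A' B' →
      p * #A' = #A → #B' = #B → SatisfiesT2 A' ∧ SatisfiesT2 B')
    (hA : cyclotomic (p ^ M.factorization p) ℤ ∣ mask A)
    (hs : SlabTiling p A B) : SatisfiesT2 A ∧ SatisfiesT2 B := by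
  have : NeZero M := ⟨hM⟩
  have hQ : IsPrimePow (p ^ M.factorization p) :=
    hp.isPrimePow.pow (hp.factorization_pos_of_dvd hM hpM).ne'
  constructor
  · intro S hS hSA hc
    have hdvd : ∀ S' ⊆ S, p ^ M.factorization p ∉ S' → ∀ s ∈ S', s ∣ M / p :=
      fun S' hS' hQS s hs' => primePow_dvd_div_of_dvd hp hM hpM (hSA s (hS' hs')).1
        (hAB.primePowerDivisors (hSA s (hS' hs')).1 (hSA s (hS' hs')).2).1
        (fun h => hQS (h ▸ hs'))
    have hslab : ∀ S' ⊆ S, p ^ M.factorization p ∉ S' → S'.Nonempty → ∀ t : ZMod M,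
        cyclotomic (∏ s ∈ S', s) ℤ ∣ mask (slab p (translate A t)) :=
      fun S' hS' hQS hne t => (hs.cyclotomic_prod_dvd hp hM hpM hAB hT2 t hne (hdvd S' hS' hQS)
        (fun s h => (hSA s (hS' h)).1)
        (fun s h s' h' => hc s (hS' h) s' (hS' h'))).1 fun s h => (hSA s (hS' h)).2
    have hprod : ∏ s ∈ S, s ∣ M := prod_dvd_of_coprime_nat hc fun s h =>
      (hAB.primePowerDivisors (hSA s h).1 (hSA s h).2).1
    by_cases hQS : p ^ M.factorization p ∈ S
    · rw [← mul_prod_erase S _ hQS] at hprod ⊢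
      -- If p^n is the only chosen power, the claim is the hypothesis on A; (T2) for the slabs
      -- requires a nonempty remainder.
      rcases (S.erase (p ^ M.factorization p)).eq_empty_or_nonempty with he | hne
      · rwa [he, prod_empty, mul_one]
      · refine cyclotomic_mul_dvd_mask_of_slab hp hM hpM ?_
          (hslab _ (erase_subset _ _) (notMem_erase _ _) hne)
        refine Nat.dvd_of_mul_dvd_mul_left (pow_pos hp.pos (M.factorization p)) ?_
        rwa [pow_factorization_mul]
    · exact cyclotomic_dvd_mask_of_slab hp hM hpM hprod (hslab S subset_rfl hQS hS)
  · intro S hS hSB hc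
    refine (hs.cyclotomic_prod_dvd hp hM hpM hAB hT2 0 hS (fun s h => ?_)
      (fun s h => (hSB s h).1) hc).2 fun s h => (hSB s h).2
    refine primePow_dvd_div_of_dvd hp hM hpM (hSB s h).1
      (hAB.swap.primePowerDivisors (hSB s h).1 (hSB s h).2).1 ?_
    rintro rfl
    exact (hAB.primePowerDivisors hQ hA).2 (hSB _ h).2

end CyclicTiling

theorem mainTheorem5 (M p : ℕ) (hM : M ≠ 0) (hp : p.Prime) (hpM : p ∣ M)
    (A B : Finset (ZMod M)) (hAB : CyclicTiling.IsTiling A B)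
    (hT2 : ∀ A' B' : Finset (ZMod (M / p)), CyclicTiling.IsTiling A' B' →
      p * A'.card = A.card → B'.card = B.card →
      CyclicTiling.SatisfiesT2 A' ∧ CyclicTiling.SatisfiesT2 B')
    (hA : Polynomial.cyclotomic (p ^ M.factorization p) ℤ ∣ CyclicTiling.mask A)
    (hslab : CyclicTiling.SlabTiling p A B ∨ CyclicTiling.SlabCyclotomic p A B ∨
      CyclicTiling.SlabDivisor p A B) :
    CyclicTiling.SatisfiesT2 A ∧ CyclicTiling.SatisfiesT2 B := by
  have h := CyclicTiling.isTiling_iff_uniqueSums.1 hAB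
  have hs : CyclicTiling.SlabTiling p A B := by
    rcases hslab with hs | hs | hs
    · exact hs
    · exact hs.slabTiling hp hM hpM h
    · exact hs.slabTiling hp hM hpM h
  exact hs.satisfiesT2 hp hM hpM h hT2 hA
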